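/- Let $d\ge 2$ be an integer, let $r\ge 1$, and let $\phi=[\phi_1,\dots,\phi_r]^T:\mathbb R\to\mathbb C^r$ have components in $L^1(\mathbb R)\cap L^2(\mathbb R)$ (for instance, $\phi$ continuous with compact support). Suppose that $\phi$ is an orthogonal two-direction multiscaling function with dilation factor $d$, that is: (i) there are $r\times r$ matrices $P_k^+,P_k^-$ ($k\in\mathbb Z$) such that $$\phi(x)=\sqrt d\sum_{k\in\mathbb Z}\bigl[P_k^+\phi(dx-k)+P_k^-\phi(k-dx)\bigr],$$ with unconditional convergence in $L^2(\mathbb R)$; (ii) $\phi$ generates a multiresolution approximation of $L^2(\mathbb R)$: if $V_j$ ($j\in\mathbb Z$) denotes the closed linear span in $L^2(\mathbb R)$ of the functions $\phi_i(d^jx-k)$ and $\phi_i(k-d^jx)$ with $1\le i\le r$, $k\in\mathbb Z$, then $V_j\subseteq V_{j+1}$ for all $j$, $\bigcup_j V_j$ is dense in $L^2(\mathbb R)$, $\bigcap_j V_j=\{0\}$, and the functions $\phi_i(x-k)$, $\phi_i(k-x)$ ($1\le i\le r$, $k\in\mathbb Z$) form a Riesz basis of $V_0$; (iii) for all $j,k\in\mathbb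 Z$, $$\int_{\mathbb R}\phi(x-j)\,\phi(x-k)^*\,dx=\delta_{jk}I_r,\qquad \int_{\mathbb R}\phi(x-j)\,\phi(k-x)^*\,dx=O,$$ where $*$ denotes the conjugate transpose. Let $\Phi(x)=\begin{bmatrix}\phi(x)\\ \phi(-x)\end{bmatrix}\in\mathbb C^{2r}$ and let $\mathbf m_0^\pm=\int_{-\infty}^{\infty}\Phi(x)\,dx$ be its zeroth continuous moment. Then $$(\mathbf m_0^\pm)^*\,\mathbf m_0^\pm=1.$$ -/

import Mathlib

open MeasureTheory Filter Topology
open scoped Matrix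

/-- The doubled function `Φ(x) = [φ(x), φ(-x)]ᵀ`, a vector of `2r` functions: the `inl` entries
are those of `φ(x)`, the `inr` entries those of `φ(-x)`. -/
def doubled {r : ℕ} (φ : ℝ → Fin r → ℂ) (x : ℝ) : Fin r ⊕ Fin r → ℂ :=
  Sum.elim (φ x) (φ (-x))

/-- The `j`-th continuous moment `∫ x ^ j F(x) dx` of a vector of functions. -/
noncomputable def continuousMoment {ι : Type*} [Fintype ι] (F : ℝ → ι → ℂ) (j : ℕ) : ι → ℂ :=
  ∫ x : ℝ, ((x : ℂ) ^ j) • F x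

/-- The matrix-valued inner product `⟨F, G⟩ = ∫ F(x) G(x)^* dx`. -/
noncomputable def innerMatrix {r : ℕ} (F G : ℝ → Fin r → ℂ) : Matrix (Fin r) (Fin r) ℂ :=
  Matrix.of fun a b => ∫ x : ℝ, F x a * star (G x b)

/-- The two-direction recursion relation
`φ(x) = √d ∑ₖ [P⁺ₖ φ(dx - k) + P⁻ₖ φ(k - dx)]`, the series converging unconditionally
in `L²(ℝ)` (for compactly supported orthogonal `φ` it has only finitely many nonzero terms). -/
def SatisfiesRecursion {r : ℕ} (d : ℕ) (φ : ℝ → Fin r → ℂ)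
    (Pp Pm : ℤ → Matrix (Fin r) (Fin r) ℂ) : Prop :=
  Tendsto (fun s : Finset ℤ =>
      eLpNorm (fun x : ℝ => φ x - ((Real.sqrt d : ℝ) : ℂ) •
        ∑ k ∈ s, (Pp k *ᵥ φ ((d : ℝ) * x - k) + Pm k *ᵥ φ ((k : ℝ) - (d : ℝ) * x))) 2 volume)
    atTop (𝓝 0)

/-- The space `V_j`: the closed linear span in `L²(ℝ)` of the functions `φ_i(d^j x - k)` and
`φ_i(k - d^j x)`, for `1 ≤ i ≤ r` and `k ∈ ℤ`. -/
noncomputable def scalingSpace {r : ℕ} (d : ℕ) (φ : ℝ → Fin r → ℂ) (j : ℤ) :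
    Submodule ℂ (Lp ℂ 2 (volume : Measure ℝ)) :=
  (Submodule.span ℂ {g : Lp ℂ 2 (volume : Measure ℝ) | ∃ (i : Fin r) (k : ℤ),
    (g =ᵐ[volume] fun x : ℝ => φ ((d : ℝ) ^ j * x - k) i) ∨
    (g =ᵐ[volume] fun x : ℝ => φ ((k : ℝ) - (d : ℝ) ^ j * x) i)}).topologicalClosure

/-- `φ` generates a multiresolution approximation of `L²(ℝ)` with dilation factor `d`. The
spaces `V_j` are by construction closed, `d`-adic dilates of `V_0`, and `V_0` is invariant under
integer translations; the remaining requirements are listed here. -/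
structure GeneratesMRA {r : ℕ} (d : ℕ) (φ : ℝ → Fin r → ℂ) : Prop where
  nested : ∀ j : ℤ, scalingSpace d φ j ≤ scalingSpace d φ (j + 1)
  dense_union : (⨆ j : ℤ, scalingSpace d φ j).topologicalClosure = ⊤
  trivial_inter : (⨅ j : ℤ, scalingSpace d φ j) = ⊥
  /-- The functions `φ_i(x - k)` and `φ_i(k - x)` form a Riesz basis of `V_0`. -/
  stable : ∃ A B : ℝ, 0 < A ∧ 0 < B ∧ ∀ c : ((Fin r ⊕ Fin r) × ℤ) →₀ ℂ,
    A * (∑ p ∈ c.support, ‖c p‖ ^ 2) ≤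
        ∫ x : ℝ, ‖∑ p ∈ c.support, c p * doubled φ (x - p.2) p.1‖ ^ 2 ∧
    ∫ x : ℝ, ‖∑ p ∈ c.support, c p * doubled φ (x - p.2) p.1‖ ^ 2 ≤
        B * (∑ p ∈ c.support, ‖c p‖ ^ 2)

/-- `φ` is a two-direction multiscaling function of multiplicity `r` and dilation factor `d`. -/
structure IsTwoDirectionMultiscaling {r : ℕ} (d : ℕ) (φ : ℝ → Fin r → ℂ) : Prop where
  memLp_two : MemLp φ 2 volume
  recursion : ∃ Pp Pm : ℤ → Matrix (Fin r) (Fin r) ℂ, SatisfiesRecursion d φ Pp Pm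
  generates : GeneratesMRA d φ

/-- Orthogonality of `φ`: `⟨φ(x - j), φ(x - k)⟩ = δ_{jk} I_r` and
`⟨φ(x - j), φ(k - x)⟩ = O` for all integers `j, k`. -/
structure IsTwoDirectionOrthogonal {r : ℕ} (φ : ℝ → Fin r → ℂ) : Prop where
  same : ∀ j k : ℤ, innerMatrix (fun x => φ (x - j)) (fun x => φ (x - k)) =
    if j = k then 1 else 0
  opposite : ∀ j k : ℤ, innerMatrix (fun x => φ (x - j)) (fun x => φ (k - x)) = 0

/-! Expand the indicator of `(0, 1]` in the orthonormal basis `√N ψ_p(N x + k)` of `V_n`, where `N =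
d ^ n` and the `ψ_p` are the entries of `doubled φ`. Since the `V_n` increase to a dense union,
Parseval makes the coefficient energies tend to the squared norm of the indicator, which is 1
(`tendsto_tsum_sq_norm_inner`). The same energies are `N⁻¹ ∑ₖ |∫_{(k, k+N]} ψ_p|²`, summed over `p`.
Written as a double integral, the sum over `k` gives each pair `(x, y)` the weight (number of
windows containing both) / `N`, which lies in `[0, 1]` and tends to 1; so the limit is `∑_p |∫
ψ_p|²` (`tendsto_tsum_sq_norm_window`). Uniqueness of limits concludes. -/

/-! ### Parseval along an increasing family of subspaces. -/

section Hilbert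

variable {E ι : Type*} [NormedAddCommGroup E] [InnerProductSpace ℂ E] [CompleteSpace E]

/-- Parseval's identity for the orthogonal projection onto the closed span of an orthonormal
family. -/
theorem Orthonormal.tsum_sq_norm_inner_eq {v : ι → E} (hv : Orthonormal ℂ v)
    {U : Submodule ℂ E} [U.HasOrthogonalProjection]
    (hU : U = (Submodule.span ℂ (Set.range v)).topologicalClosure) (f : E) :
    ∑' i, ‖inner ℂ (v i) f‖ ^ 2 = ‖U.starProjection f‖ ^ 2 := by
  have hmem : ∀ i, v i ∈ U := fun i => by
    rw [hU]
    exact Submodule.le_topologicalClosure _ (Submodule.subset_span ⟨i, rfl⟩)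
  have : CompleteSpace U := by
    subst hU
    exact (Submodule.isClosed_topologicalClosure _).completeSpace_coe
  let w : ι → U := fun i => ⟨v i, hmem i⟩
  have hw : Orthonormal ℂ w := by
    refine ⟨fun i => hv.1 i, fun i j hij => hv.2 hij⟩
  -- A vector of `U` orthogonal to every `v i` is orthogonal to their closed span, which is `U`,
  -- hence to itself.
  have hbot : (Submodule.span ℂ (Set.range w))ᗮ = ⊥ := by
    rw [Submodule.eq_bot_iff]
    intro x hx
    have h1 : (x : E) ∈ (Submodule.span ℂ (Set.range v))ᗮ := by
      rw [Submodule.mem_orthogonal]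
      intro u hu
      induction hu using Submodule.span_induction with
      | mem u hu =>
        obtain ⟨i, rfl⟩ := hu
        exact (Submodule.mem_orthogonal _ _).1 hx (w i) (Submodule.subset_span ⟨i, rfl⟩)
      | zero => simp
      | add a b _ _ ha hb => rw [inner_add_left, ha, hb, add_zero]
      | smul c a _ ha => rw [inner_smul_left, ha, mul_zero]
    rw [← Submodule.orthogonal_closure, ← hU] at h1
    have h2 : inner ℂ (x : E) (x : E) = 0 := (Submodule.mem_orthogonal _ _).1 h1 _ x.2
    exact Subtype.ext (inner_self_eq_zero.1 h2)
  let b := HilbertBasis.mkOfOrthogonalEqBot hw hbot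
  have hb : ∀ i, b i = w i := fun i => by
    rw [HilbertBasis.coe_mkOfOrthogonalEqBot]
  set y : U := U.orthogonalProjectionOnto f with hy
  have hinner : ∀ i, inner ℂ (b i) y = inner ℂ (v i) f := fun i => by
    rw [hb, hy]
    exact Submodule.inner_orthogonalProjectionOnto_eq_of_mem_left (w i) f
  have hs := b.hasSum_inner_mul_inner y y
  have hs' : HasSum (fun i => ((‖inner ℂ (v i) f‖ ^ 2 : ℝ) : ℂ)) ((‖y‖ ^ 2 : ℝ) : ℂ) := by
    convert! hs using 1
    · funext i
      rw [← hinner i, ← inner_conj_symm y (b i), Complex.conj_mul']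
      push_cast
      rfl
    · rw [inner_self_eq_norm_sq_to_K]
      push_cast
      rfl
  exact (Complex.hasSum_ofReal.1 hs').tsum_eq

/-- The coefficient energies of `f` with respect to orthonormal bases of an increasing family of
closed subspaces with dense union converge to `‖f‖ ^ 2`. -/
theorem tendsto_tsum_sq_norm_inner {v : ℕ → ι → E} (hv : ∀ n, Orthonormal ℂ (v n))
    {U : ℤ → Submodule ℂ E}
    (hU : ∀ n : ℕ, U n = (Submodule.span ℂ (Set.range (v n))).topologicalClosure)
    (hclosed : ∀ j, IsClosed (U j : Set E)) (hmono : Monotone U)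
    (hdense : (⨆ j, U j).topologicalClosure = ⊤) (f : E) :
    Tendsto (fun n => ∑' i, ‖inner ℂ (v n i) f‖ ^ 2) atTop (𝓝 (‖f‖ ^ 2)) := by
  have : ∀ j, CompleteSpace (U j) := fun j => (hclosed j).completeSpace_coe
  have h := (Submodule.starProjection_tendsto_self U hmono f hdense.ge).comp
    (tendsto_natCast_atTop_atTop (R := ℤ))
  refine (h.norm.pow 2).congr fun n => ?_
  exact ((hv n).tsum_sq_norm_inner_eq (hU n) f).symm

end Hilbert

/-! ### Averages over sliding integer windows. -/

section Counting

/-- The number of integers `k` with `k < a ≤ k + N` and `k < b ≤ k + N`. -/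
noncomputable def commonWindows (N : ℕ) (a b : ℤ) : ℕ :=
  (Finset.Ico (max a b - N) (min a b)).card

theorem commonWindows_le (N : ℕ) (a b : ℤ) : commonWindows N a b ≤ N := by
  rw [commonWindows, Int.card_Ico]
  omega

/-- When `|a - b| > N` the interval is empty and the left side is negative, so the bound survives
truncation. -/
theorem le_commonWindows (N : ℕ) (a b : ℤ) :
    (N : ℤ) - |a - b| ≤ commonWindows N a b := by
  rw [commonWindows, Int.card_Ico, ← max_sub_min_eq_abs]
  omega

theorem tendsto_commonWindows_div (a b : ℤ) :
    Tendsto (fun N : ℕ => (commonWindows N a b : ℝ) / N) atTop (𝓝 1) := by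
  have h1 : Tendsto (fun N : ℕ => 1 - |(a : ℝ) - b| / N) atTop (𝓝 1) := by
    simpa using tendsto_const_nhds.sub
      (tendsto_const_div_atTop_nhds_zero_nat |(a : ℝ) - b|)
  refine tendsto_of_tendsto_of_tendsto_of_le_of_le' h1 tendsto_const_nhds ?_ ?_
  · filter_upwards [eventually_gt_atTop 0] with N hN
    have hN' : (0 : ℝ) < N := by exact_mod_cast hN
    rw [le_div_iff₀ hN', sub_mul, div_mul_cancel₀ _ hN'.ne', one_mul]
    exact_mod_cast le_commonWindows N a b
  · filter_upwards with N
    exact div_le_one_of_le₀ (by exact_mod_cast commonWindows_le N a b) (Nat.cast_nonneg N)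

theorem mem_Ioc_window_iff (N : ℕ) (k : ℤ) (x : ℝ) :
    x ∈ Set.Ioc (k : ℝ) (k + N) ↔ k < ⌈x⌉ ∧ ⌈x⌉ ≤ k + N := by
  rw [Set.mem_Ioc, Int.lt_ceil, Int.ceil_le]
  push_cast
  rfl

/-- Each pair of reals lies in exactly `commonWindows` of the windows `(k, k + N]`. -/
theorem hasSum_indicator_windows {R : Type*} [NormedRing R] [NormedAlgebra ℝ R] (N : ℕ)
    (F : ℝ × ℝ → R) (z : ℝ × ℝ) :
    HasSum (fun k : ℤ => (Set.Ioc (k : ℝ) (k + N) ×ˢ Set.Ioc (k : ℝ) (k + N)).indicator F z)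
      ((commonWindows N ⌈z.1⌉ ⌈z.2⌉ : ℝ) • F z) := by
  have hmem : ∀ k : ℤ, z ∈ Set.Ioc (k : ℝ) (k + N) ×ˢ Set.Ioc (k : ℝ) (k + N) ↔
      k ∈ Finset.Ico (max ⌈z.1⌉ ⌈z.2⌉ - N) (min ⌈z.1⌉ ⌈z.2⌉) := fun k => by
    rw [Set.mem_prod, mem_Ioc_window_iff, mem_Ioc_window_iff, Finset.mem_Ico]
    omega
  have h := hasSum_sum_of_ne_finset_zero (L := .unconditional ℤ)
    (f := fun k : ℤ => (Set.Ioc (k : ℝ) (k + N) ×ˢ Set.Ioc (k : ℝ) (k + N)).indicator F z)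
    (s := Finset.Ico (max ⌈z.1⌉ ⌈z.2⌉ - N) (min ⌈z.1⌉ ⌈z.2⌉))
    (fun k hk => Set.indicator_of_notMem (fun hz => hk ((hmem k).1 hz)) _)
  convert! h using 1
  rw [Finset.sum_congr rfl fun k hk => Set.indicator_of_mem ((hmem k).2 hk) F,
    Finset.sum_const, commonWindows, Nat.cast_smul_eq_nsmul]

theorem measurable_commonWindows_ceil (N : ℕ) :
    Measurable fun z : ℝ × ℝ => (commonWindows N ⌈z.1⌉ ⌈z.2⌉ : ℝ) := by
  have h : Measurable fun p : ℤ × ℤ => (commonWindows N p.1 p.2 : ℝ) := measurable_of_countable _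
  have hc : Measurable fun z : ℝ × ℝ => (⌈z.1⌉, ⌈z.2⌉) :=
    measurable_fst.ceil.prodMk measurable_snd.ceil
  simpa only [Function.comp_def] using h.comp hc

variable {ψ : ℝ → ℂ}

theorem integral_mul_conj_prod (μ : Measure ℝ) [SFinite μ] :
    ∫ z, ψ z.1 * star (ψ z.2) ∂(μ.prod μ) = ((‖∫ x, ψ x ∂μ‖ ^ 2 : ℝ) : ℂ) := by
  rw [integral_prod_mul (f := ψ) (g := fun y => star (ψ y))]
  have : ∫ y, star (ψ y) ∂μ = star (∫ y, ψ y ∂μ) := integral_conj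
  rw [this]
  push_cast
  exact Complex.mul_conj' _

theorem integrable_mul_conj_prod (hψ : Integrable ψ) :
    Integrable fun z : ℝ × ℝ => ψ z.1 * star (ψ z.2) :=
  hψ.mul_prod (g := fun y => star (ψ y)) (by simpa using (Complex.conjCLE : ℂ →L[ℝ] ℂ).integrable_comp hψ)

theorem integrable_commonWindows_smul {R : Type*} [NormedAddCommGroup R] [NormedSpace ℝ R]
    (N : ℕ) {F : ℝ × ℝ → R} (hF : Integrable F) :
    Integrable fun z : ℝ × ℝ => (commonWindows N ⌈z.1⌉ ⌈z.2⌉ : ℝ) • F z := by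
  refine hF.bdd_smul N (measurable_commonWindows_ceil N).aestronglyMeasurable
    (Eventually.of_forall fun z => ?_)
  simpa using commonWindows_le N ⌈z.1⌉ ⌈z.2⌉

/-- By Fubini each squared window integral is the integral of `ψ(x) * star ψ(y)` over a square;
summing over `k` counts the squares containing `(x, y)`. -/
theorem hasSum_sq_norm_window (hψ : Integrable ψ) (N : ℕ) :
    HasSum (fun k : ℤ => ((‖∫ x in Set.Ioc (k : ℝ) (k + N), ψ x‖ ^ 2 : ℝ) : ℂ))
      (∫ z : ℝ × ℝ, (commonWindows N ⌈z.1⌉ ⌈z.2⌉ : ℝ) • (ψ z.1 * star (ψ z.2))) := by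
  set F : ℝ × ℝ → ℂ := fun z => ψ z.1 * star (ψ z.2) with hF
  have hFint : Integrable F := integrable_mul_conj_prod hψ
  have hms : ∀ k : ℤ, MeasurableSet (Set.Ioc (k : ℝ) (k + N) ×ˢ Set.Ioc (k : ℝ) (k + N)) :=
    fun k => measurableSet_Ioc.prod measurableSet_Ioc
  have h := hasSum_integral_of_dominated_convergence (μ := (volume : Measure (ℝ × ℝ)))
    (F := fun (k : ℤ) (z : ℝ × ℝ) =>
      (Set.Ioc (k : ℝ) (k + N) ×ˢ Set.Ioc (k : ℝ) (k + N)).indicator F z)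
    (f := fun z => (commonWindows N ⌈z.1⌉ ⌈z.2⌉ : ℝ) • F z)
    (fun (k : ℤ) (z : ℝ × ℝ) =>
      (Set.Ioc (k : ℝ) (k + N) ×ˢ Set.Ioc (k : ℝ) (k + N)).indicator (fun z => ‖F z‖) z)
    (fun k => hFint.aestronglyMeasurable.indicator (hms k))
    (fun k => Eventually.of_forall fun z => by rw [norm_indicator_eq_indicator_norm])
    (Eventually.of_forall fun z => (hasSum_indicator_windows N (fun z => ‖F z‖) z).summable)
    -- The dominating series sums to at most `N ‖F‖`, which is integrable.
    (by
      simp_rw [fun z => (hasSum_indicator_windows N (fun z => ‖F z‖) z).tsum_eq]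
      exact integrable_commonWindows_smul N hFint.norm)
    (Eventually.of_forall fun z => hasSum_indicator_windows N F z)
  convert! h using 2 with k
  rw [integral_indicator (hms k), Measure.volume_eq_prod, ← Measure.prod_restrict,
    integral_mul_conj_prod]

/-- Averages of the energies of all integer windows of length `N` tend to `‖∫ ψ‖ ^ 2`. -/
theorem tendsto_tsum_sq_norm_window (hψ : Integrable ψ) :
    Tendsto (fun N : ℕ => (N : ℝ)⁻¹ * ∑' k : ℤ, ‖∫ x in Set.Ioc (k : ℝ) (k + N), ψ x‖ ^ 2)
      atTop (𝓝 (‖∫ x, ψ x‖ ^ 2)) := by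
  have hFint := integrable_mul_conj_prod hψ
  have key : Tendsto (fun N : ℕ => ∫ z : ℝ × ℝ,
      ((commonWindows N ⌈z.1⌉ ⌈z.2⌉ : ℝ) / N) • (ψ z.1 * star (ψ z.2))) atTop
      (𝓝 (∫ z : ℝ × ℝ, (1 : ℝ) • (ψ z.1 * star (ψ z.2)))) := by
    refine tendsto_integral_of_dominated_convergence (fun z => ‖ψ z.1 * star (ψ z.2)‖)
      (fun N => ?_) hFint.norm (fun N => Eventually.of_forall fun z => ?_)
      (Eventually.of_forall fun z => (tendsto_commonWindows_div _ _).smul_const _)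
    · exact ((measurable_commonWindows_ceil N).div_const _).aestronglyMeasurable.smul
        hFint.aestronglyMeasurable
    · rw [norm_smul, Real.norm_of_nonneg (by positivity)]
      refine mul_le_of_le_one_left (norm_nonneg _) (div_le_one_of_le₀ ?_ (Nat.cast_nonneg N))
      exact_mod_cast commonWindows_le N _ _
  simp only [one_smul] at key
  rw [Measure.volume_eq_prod, integral_mul_conj_prod] at key
  have key' := (Complex.continuous_re.tendsto _).comp key
  rw [Complex.ofReal_re] at key'
  refine key'.congr fun N => ?_
  have hs := (hasSum_sq_norm_window hψ N).tsum_eq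
  rw [← Complex.ofReal_tsum] at hs
  simp only [Function.comp_apply, div_eq_inv_mul, mul_smul]
  rw [integral_smul, ← Measure.volume_eq_prod, ← hs, Complex.real_smul, ← Complex.ofReal_mul,
    Complex.ofReal_re]

end Counting

/-! ### Dilated translates as an orthonormal family in `L²`. -/

section Dilation

theorem MeasureTheory.MemLp.comp_mul_add {E : Type*} [NormedAddCommGroup E] {f : ℝ → E}
    {p : ENNReal} (hf : MemLp f p volume) {a : ℝ} (ha : a ≠ 0) (b : ℝ) :
    MemLp (fun x => f (a * x + b)) p volume := by
  have h1 : MemLp (fun x => f (x + b)) p volume :=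
    hf.comp_measurePreserving (measurePreserving_add_right volume b)
  refine MemLp.comp_of_map (f := fun x => a * x) (g := fun x => f (x + b)) ?_ (by fun_prop)
  rw [Real.map_volume_mul_left ha]
  exact h1.smul_measure ENNReal.ofReal_ne_top

theorem integral_comp_mul_add_volume {E : Type*} [NormedAddCommGroup E] [NormedSpace ℝ E]
    (f : ℝ → E) (a b : ℝ) : ∫ x, f (a * x + b) = |a⁻¹| • ∫ x, f x := by
  rw [Measure.integral_comp_mul_left (fun x => f (x + b)), integral_add_right_eq_self]

variable {ι : Type*} {ψ : ι → ℝ → ℂ}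

/-- The normalised dilated translates `√N ψ_p (N x + k)` as elements of `L²(ℝ)`. -/
noncomputable def dilatedTranslate (hψ : ∀ p, MemLp (ψ p) 2 volume) {N : ℝ} (hN : 0 < N)
    (q : ι × ℤ) : Lp ℂ 2 (volume : Measure ℝ) :=
  ((√N : ℝ) : ℂ) • ((hψ q.1).comp_mul_add hN.ne' q.2).toLp _

theorem orthonormal_dilatedTranslate [DecidableEq ι] (hψ : ∀ p, MemLp (ψ p) 2 volume) {N : ℝ}
    (hN : 0 < N)
    (h : ∀ (p q : ι) (j k : ℤ), ∫ x, ψ p (x - j) * star (ψ q (x - k)) =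
      if (p, j) = (q, k) then 1 else 0) :
    Orthonormal ℂ (dilatedTranslate hψ hN) := by
  classical
  rw [orthonormal_iff_ite]
  rintro ⟨p, j⟩ ⟨q, k⟩
  rw [dilatedTranslate, dilatedTranslate, inner_smul_left, inner_smul_right, L2.inner_def]
  have h1 : ∫ x, inner ℂ (((hψ p).comp_mul_add hN.ne' j).toLp _ x)
      (((hψ q).comp_mul_add hN.ne' k).toLp _ x) =
      ∫ x, ψ q (N * x + k) * star (ψ p (N * x + j)) := by
    refine integral_congr_ae ?_
    filter_upwards [((hψ p).comp_mul_add hN.ne' j).coeFn_toLp,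
      ((hψ q).comp_mul_add hN.ne' k).coeFn_toLp] with x hx hy
    rw [hx, hy]
    exact RCLike.inner_apply _ _
  have h2 := integral_comp_mul_add_volume (fun x => ψ q (x + k) * star (ψ p (x + j))) N 0
  -- The signs turn `x - k` into `x + k`; the swap arises because the inner product conjugates its
  -- first argument.
  have h3 := h q p (-k) (-j)
  simp only [Int.cast_neg, sub_neg_eq_add] at h3
  simp only [add_zero] at h2
  rw [h1, h2, h3, Complex.conj_ofReal, ← mul_assoc, ← Complex.ofReal_mul,
    Real.mul_self_sqrt hN.le, abs_of_pos (inv_pos.2 hN), Complex.real_smul, ← mul_assoc,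
    ← Complex.ofReal_mul, mul_inv_cancel₀ hN.ne', Complex.ofReal_one, one_mul]
  refine if_congr ?_ rfl rfl
  simp only [Prod.mk.injEq, neg_inj]
  exact and_congr eq_comm eq_comm

/-- The substitution `y = N x + k` carries `(0, 1]` to `(k, k + N]`; the factor `√N * N⁻¹` squares
to `N⁻¹`. -/
theorem sq_norm_inner_dilatedTranslate_indicator (hψ : ∀ p, MemLp (ψ p) 2 volume) {N : ℕ}
    (hN : (0 : ℝ) < N) (p : ι) (k : ℤ) :
    ‖inner ℂ (dilatedTranslate hψ hN (p, k))
      (indicatorConstLp 2 (measurableSet_Ioc (a := (0 : ℝ)) (b := 1)) (by simp) (1 : ℂ))‖ ^ 2 =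
      (N : ℝ)⁻¹ * ‖∫ x in Set.Ioc (k : ℝ) (k + N), ψ p x‖ ^ 2 := by
  rw [norm_inner_symm, dilatedTranslate, inner_smul_right, L2.inner_indicatorConstLp_one]
  have h1 : ∫ x in Set.Ioc (0 : ℝ) 1, ((hψ p).comp_mul_add hN.ne' k).toLp _ x =
      ∫ x in (0 : ℝ)..1, ψ p (N * x + k) := by
    rw [intervalIntegral.integral_of_le zero_le_one]
    exact setIntegral_congr_ae measurableSet_Ioc
      (((hψ p).comp_mul_add hN.ne' k).coeFn_toLp.mono fun x hx _ => hx)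
  rw [h1, intervalIntegral.integral_comp_mul_add _ hN.ne', mul_zero, zero_add, mul_one,
    add_comm (N : ℝ), intervalIntegral.integral_of_le (by linarith), norm_mul, norm_smul,
    mul_pow, mul_pow, Complex.norm_real, Real.norm_of_nonneg (Real.sqrt_nonneg _),
    Real.sq_sqrt hN.le, Real.norm_of_nonneg (inv_nonneg.2 hN.le)]
  field_simp

theorem sq_norm_indicatorConstLp_Ioc :
    ‖indicatorConstLp 2 (measurableSet_Ioc (a := (0 : ℝ)) (b := 1)) (μ := volume) (by simp)
      (1 : ℂ)‖ ^ 2 = 1 := by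
  rw [norm_indicatorConstLp (by simp) (by simp)]
  simp

end Dilation

/-! ### Application to the doubled scaling function. -/

section Multiscaling

variable {r d : ℕ} {φ : ℝ → Fin r → ℂ}

theorem memLp_doubled {q : ENNReal} (h : MemLp φ q volume) (p : Fin r ⊕ Fin r) :
    MemLp (fun x => doubled φ x p) q volume := by
  rcases p with a | a
  · exact memLp_pi_iff.1 h a
  · exact (memLp_pi_iff.1 h a).comp_measurePreserving (Measure.measurePreserving_neg volume)

theorem IsTwoDirectionOrthogonal.integral_doubled (h : IsTwoDirectionOrthogonal φ)
    (p q : Fin r ⊕ Fin r) (j k : ℤ) :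
    ∫ x : ℝ, doubled φ (x - j) p * star (doubled φ (x - k) q) =
      if (p, j) = (q, k) then 1 else 0 := by
  have hsame : ∀ (a b : Fin r) (j k : ℤ), ∫ x : ℝ, φ (x - j) a * star (φ (x - k) b) =
      if a = b ∧ j = k then 1 else 0 := fun a b j k => by
    have := congrFun (congrFun (h.same j k) a) b
    simp only [innerMatrix, Matrix.of_apply] at this
    rw [this]
    by_cases hjk : j = k
    · simp [hjk, Matrix.one_apply]
    · simp [hjk]
  have hopp : ∀ (a b : Fin r) (j k : ℤ), ∫ x : ℝ, φ (x - j) a * star (φ (k - x) b) = 0 :=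
    fun a b j k => by simpa [innerMatrix] using congrFun (congrFun (h.opposite j k) a) b
  rcases p with a | a <;> rcases q with b | b
  · simpa [doubled, Prod.ext_iff] using hsame a b j k
  · simpa [doubled] using hopp a b j k
  · have h1 : ∫ x : ℝ, star (φ (x - k) b * star (φ (j - x) a)) = star (0 : ℂ) := by
      rw [← hopp b a k j]
      exact integral_conj
    simpa [doubled, mul_comm] using h1
  -- The reflection `x ↦ -x` reduces two reflected entries to two unreflected ones.
  · have h1 := hsame a b (-j) (-k)
    rw [← integral_neg_eq_self] at h1
    simpa [doubled, neg_add_eq_sub] using h1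

/-- The generators agree up to the nonzero scalar `√N` and `k ↦ -k`: `φ_i(k - N x)` is the `inr i`
entry of `doubled φ` at `N x - k`. -/
theorem scalingSpace_eq_closure_span (hφ : MemLp φ 2 volume) (n : ℕ) {N : ℝ} (hN : 0 < N)
    (hNd : (d : ℝ) ^ n = N) :
    scalingSpace d φ n = (Submodule.span ℂ
      (Set.range (dilatedTranslate (memLp_doubled hφ) hN))).topologicalClosure := by
  have hsqrt : ((√N : ℝ) : ℂ) ≠ 0 := by
    exact_mod_cast (Real.sqrt_pos.2 hN).ne'
  have hcoe : ∀ (p : Fin r ⊕ Fin r) (k : ℤ),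
      ((memLp_doubled hφ p).comp_mul_add hN.ne' k).toLp _ =ᵐ[volume]
        fun x => doubled φ (N * x + k) p := fun p k => MemLp.coeFn_toLp _
  have hmem : ∀ (p : Fin r ⊕ Fin r) (k : ℤ),
      ((memLp_doubled hφ p).comp_mul_add hN.ne' k).toLp _ ∈
        Submodule.span ℂ (Set.range (dilatedTranslate (memLp_doubled hφ) hN)) := fun p k => by
    rw [← Submodule.smul_mem_iff _ hsqrt]
    exact Submodule.subset_span ⟨(p, k), rfl⟩
  rw [scalingSpace]
  congr 1
  simp only [zpow_natCast, hNd]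
  refine le_antisymm (Submodule.span_le.2 ?_) (Submodule.span_le.2 ?_)
  · rintro g ⟨i, k, hg | hg⟩
    · rw [Lp.ext (hg.trans (((hcoe (Sum.inl i) (-k)).trans ?_).symm))]
      · exact hmem _ _
      · simp [doubled, sub_eq_add_neg]
    · rw [Lp.ext (hg.trans (((hcoe (Sum.inr i) (-k)).trans ?_).symm))]
      · exact hmem _ _
      · simp [doubled, sub_eq_add_neg]
  · rintro _ ⟨⟨p, k⟩, rfl⟩
    refine Submodule.smul_mem _ _ (Submodule.subset_span ?_)
    rcases p with i | i
    · refine ⟨i, -k, Or.inl ((hcoe _ _).trans ?_)⟩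
      simp [doubled]
    · refine ⟨i, -k, Or.inr ((hcoe _ _).trans ?_)⟩
      simp [doubled, sub_eq_add_neg, add_comm]

/-- The components of the zeroth moment of the doubled function have total energy one. -/
theorem sum_sq_norm_integral_doubled (hd : 2 ≤ d) (hint : Integrable φ volume)
    (hφ : IsTwoDirectionMultiscaling d φ) (horth : IsTwoDirectionOrthogonal φ) :
    ∑ p, ‖∫ x, doubled φ x p‖ ^ 2 = 1 := by
  have hN : ∀ n : ℕ, (0 : ℝ) < ((d ^ n : ℕ) : ℝ) := fun n => by positivity
  have hon : ∀ n, Orthonormal ℂ (dilatedTranslate (memLp_doubled hφ.memLp_two) (hN n)) :=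
    fun n => orthonormal_dilatedTranslate _ _ horth.integral_doubled
  have hψ : ∀ p, Integrable fun x => doubled φ x p := fun p =>
    memLp_one_iff_integrable.1 (memLp_doubled (memLp_one_iff_integrable.2 hint) p)
  have h1 := tendsto_tsum_sq_norm_inner hon
    (fun n => scalingSpace_eq_closure_span hφ.memLp_two n (hN n) (by push_cast; rfl))
    (fun j => Submodule.isClosed_topologicalClosure _)
    (monotone_int_of_le_succ hφ.generates.nested) hφ.generates.dense_union
    (indicatorConstLp 2 (measurableSet_Ioc (a := (0 : ℝ)) (b := 1)) (by simp) (1 : ℂ))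
  rw [sq_norm_indicatorConstLp_Ioc] at h1
  have h2 := tendsto_finsetSum (Finset.univ : Finset (Fin r ⊕ Fin r)) fun p _ =>
    (tendsto_tsum_sq_norm_window (hψ p)).comp (tendsto_pow_atTop_atTop_of_one_lt (by omega : 1 < d))
  refine tendsto_nhds_unique h2 (h1.congr fun n => ?_)
  have hs := (hon n).inner_products_summable
    (indicatorConstLp 2 (measurableSet_Ioc (a := (0 : ℝ)) (b := 1)) (by simp) (1 : ℂ))
  -- Bessel's inequality supplies the summability that lets the sum over pairs `(p, k)` be iterated.
  rw [hs.tsum_prod, tsum_fintype]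
  simp only [sq_norm_inner_dilatedTranslate_indicator, tsum_mul_left, Function.comp_apply]

theorem continuousMoment_zero_apply {ι : Type*} [Fintype ι] {F : ℝ → ι → ℂ}
    (hF : ∀ i, Integrable fun x => F x i) (i : ι) :
    continuousMoment F 0 i = ∫ x, F x i := by
  simp only [continuousMoment, pow_zero, one_smul]
  exact eval_integral hF i

end Multiscaling

theorem theorem3p4 (r d : ℕ) (hd : 2 ≤ d) (φ : ℝ → Fin r → ℂ)
    (hint : Integrable φ volume)
    (hφ : IsTwoDirectionMultiscaling d φ)
    (horth : IsTwoDirectionOrthogonal φ) :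
    star (continuousMoment (doubled φ) 0) ⬝ᵥ continuousMoment (doubled φ) 0 = 1 := by
  have hψ : ∀ p, Integrable fun x => doubled φ x p := fun p =>
    memLp_one_iff_integrable.1 (memLp_doubled (memLp_one_iff_integrable.2 hint) p)
  have h := congrArg (fun t : ℝ => (t : ℂ)) (sum_sq_norm_integral_doubled hd hint hφ horth)
  simp only [Complex.ofReal_sum, Complex.ofReal_one, Complex.ofReal_pow] at h
  rw [← h, dotProduct]
  refine Finset.sum_congr rfl fun p _ => ?_
  rw [Pi.star_apply, continuousMoment_zero_apply hψ]
  exact Complex.conj_mul' _
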